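/- For a unital ring $R$ let $Lg_k(R)$ (resp. $Rg_k(R)$) be the set of $k$-tuples of elements of $R$ that generate $R$ as a left (resp. right) ideal. For a unital Banach algebra $R$, the left (resp. right) topological stable rank $\mathrm{ltsr}(R)$ (resp. $\mathrm{rtsr}(R)$) is the least integer $k \ge 0$ such that $Lg_k(R)$ (resp. $Rg_k(R)$) is dense in $R^k$, and $\infty$ if there is no such $k$. Let $B$ be a unital complex Banach algebra and let $A \subset B$ be a closed subalgebra containing the unit of $B$. Let $E \colon B \to A$ be a linear $A$-bimodule map, and suppose that $\{(u_i, v_i)\}_{i=1}^n \subset B \times B$ is a quasi-basis for $E$, that is, $$\sum_{i=1}^n u_i E(v_i b) = b = \sum_{i=1}^n E(b u_i) v_i \qquad \text{for all } b \in B.$$ Suppose moreover that 1. $\mathrm{Index}\,E = \sum_{i=1}^n u_i v_i$ is invertible in $B$, 2. $E$ is contractive, i.e. $\|E(b)\| \le \|b\|$ for all $b \in B$, 3. the quasi-basis is orthogonal with respect to $E$, i.e. $E(v_i u_j) = \delta_{i,j} 1$ for $1 \le i, j \le n$. Then $$\mathrm{ltsr}(A) \le n\,\mathrm{ltsr}(B)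 + n^2 - n + 1,$$ and $\mathrm{ltsr}(A)$ is finite if and only if $\mathrm{ltsr}(B)$ is finite. Likewise $$\mathrm{rtsr}(A) \le n\,\mathrm{rtsr}(B) + n^2 - n + 1,$$ and $\mathrm{rtsr}(A)$ is finite if and only if $\mathrm{rtsr}(B)$ is finite. -/

import Mathlib

/-- `Lg n R`: the `n`-tuples of elements of `R` which generate `R` as a left ideal. -/
def Lg (n : ℕ) (R : Type*) [Ring R] : Set (Fin n → R) :=
  {a | Submodule.span R (Set.range a) = ⊤}

/-- `Rg n R`: the `n`-tuples of elements of `R` which generate `R` as a right ideal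
(a right ideal is a submodule for the action of the opposite ring by right multiplication). -/
def Rg (n : ℕ) (R : Type*) [Ring R] : Set (Fin n → R) :=
  {a | Submodule.span (MulOpposite R) (Set.range a) = ⊤}

/-- The left topological stable rank: the least `n` such that `Lg n R` is dense in `R ^ n`,
and `⊤` if there is no such `n`. -/
noncomputable def ltsr (R : Type*) [Ring R] [TopologicalSpace R] : ℕ∞ :=
  ⨅ (n : ℕ) (_ : Dense (Lg n R)), (n : ℕ∞)

/-- The right topological stable rank: the least `n` such that `Rg n R` is dense in `R ^ n`,
and `⊤` if there is no such `n`. -/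
noncomputable def rtsr (R : Type*) [Ring R] [TopologicalSpace R] : ℕ∞ :=
  ⨅ (n : ℕ) (_ : Dense (Rg n R)), (n : ℕ∞)

section Watatani

variable {B : Type*} [NormedRing B] [NormedAlgebra ℂ B] {A : Subalgebra ℂ B}

/-- `E : B → A` is a map of `A`-bimodules. -/
structure IsBimoduleMap (E : B →ₗ[ℂ] A) : Prop where
  map_left : ∀ (a : A) (b : B), E ((a : B) * b) = a * E b
  map_right : ∀ (b : B) (a : A), E (b * (a : B)) = E b * a

/-- The finite family `(u i, v i)` in `B × B` is a quasi-basis for `E`. -/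
structure IsQuasiBasis (E : B →ₗ[ℂ] A) {n : ℕ} (u v : Fin n → B) : Prop where
  sum_left : ∀ b : B, ∑ i, u i * (E (v i * b) : B) = b
  sum_right : ∀ b : B, ∑ i, (E (b * u i) : B) * v i = b

/-- The index `∑ u i * v i` of a map with quasi-basis `(u i, v i)`. -/
def watataniIndex {n : ℕ} (u v : Fin n → B) : B := ∑ i, u i * v i

/-- The family `(u i, v i)` is orthogonal with respect to `E`. -/
def IsOrthogonalFor (E : B →ₗ[ℂ] A) {n : ℕ} (u v : Fin n → B) : Prop :=
  ∀ i j, E (v i * u j) = if i = j then 1 else 0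

end Watatani

/-! ### Unimodular tuples and left invertible matrices -/

/-! Orthogonality makes `B` free of rank `n` over `A`: on the left with basis `v`, on the right with
basis `u`, with coordinates `E (b * u j)` and `E (v p * b)`. So tuples over `B` become matrices over
`A`, and stable rank is studied through density of left invertible rectangular matrices. Density of
`Lg k` passes up to `(k + n) × n` matrices (`dense_leftInvertibleMatrices_fin`) and, in a complete
normed ring, density descends by removing one row and one column at a time
(`dense_leftInvertibleMatrices_of_fromBlocks`). Coordinates carry density from `A` to `B`
(`dense_Lg_codomain`) and back (`dense_Lg_domain`). The right-handed case is the left-handed one for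
the opposite rings. -/

theorem mem_Lg_iff {n : ℕ} {R : Type*} [Ring R] {a : Fin n → R} :
    a ∈ Lg n R ↔ ∃ c : Fin n → R, ∑ i, c i * a i = 1 := by
  refine Iff.trans ?_ (Submodule.mem_span_range_iff_exists_fun R (x := (1 : R)) (v := a))
  exact Ideal.eq_top_iff_one (Ideal.span (Set.range a))

theorem mem_Rg_iff {n : ℕ} {R : Type*} [Ring R] {a : Fin n → R} :
    a ∈ Rg n R ↔ ∃ c : Fin n → R, ∑ i, a i * c i = 1 := by
  have h : a ∈ Rg n R ↔ (1 : R) ∈ Submodule.span (MulOpposite R) (Set.range a) := by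
    refine ⟨fun h => ?_, fun h => Submodule.eq_top_iff'.2 fun x => ?_⟩
    · rw [show Submodule.span (MulOpposite R) (Set.range a) = ⊤ from h]
      trivial
    · simpa using Submodule.smul_mem _ (MulOpposite.op x) h
  rw [h, Submodule.mem_span_range_iff_exists_fun]
  exact ⟨fun ⟨c, hc⟩ => ⟨fun i => (c i).unop, hc⟩, fun ⟨c, hc⟩ => ⟨fun i => MulOpposite.op (c i), hc⟩⟩

theorem Dense.of_mapsTo {X Y : Type*} [TopologicalSpace X] [TopologicalSpace Y] {f : X → Y}
    {s : Set X} {t : Set Y} (hs : Dense s) (hf : Continuous f) (hsurj : Function.Surjective f)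
    (h : Set.MapsTo f s t) : Dense t :=
  (hsurj.denseRange.dense_image hf hs).mono h.image_subset

/-- The matrices over `R` which admit a left inverse. -/
def leftInvertibleMatrices (ι κ R : Type*) [Fintype ι] [Fintype κ] [DecidableEq κ] [Ring R] :
    Set (Matrix ι κ R) :=
  {X | ∃ Y : Matrix κ ι R, Y * X = 1}

section LeftInvertible

variable {R ι ι' κ κ' : Type*} [Ring R] [Fintype ι] [Fintype ι'] [Fintype κ] [Fintype κ']
  [DecidableEq κ] [DecidableEq κ']

theorem mul_mem_leftInvertibleMatrices [DecidableEq ι] {K : Matrix ι' ι R} {X : Matrix ι κ R}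
    (hK : K ∈ leftInvertibleMatrices ι' ι R) (hX : X ∈ leftInvertibleMatrices ι κ R) :
    K * X ∈ leftInvertibleMatrices ι' κ R := by
  obtain ⟨L, hL⟩ := hK
  obtain ⟨Y, hY⟩ := hX
  refine ⟨Y * L, ?_⟩
  rw [Matrix.mul_assoc, ← Matrix.mul_assoc L, hL, Matrix.one_mul, hY]

variable [TopologicalSpace R]

theorem dense_leftInvertibleMatrices_reindex (e : ι ≃ ι') (f : κ ≃ κ')
    (h : Dense (leftInvertibleMatrices ι κ R)) : Dense (leftInvertibleMatrices ι' κ' R) := by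
  refine h.of_mapsTo (f := Matrix.reindex e f) ?_ (Matrix.reindex e f).surjective ?_
  · exact continuous_id.matrix_submatrix _ _
  · rintro X ⟨Y, hY⟩
    refine ⟨Matrix.reindex f e Y, ?_⟩
    simp [Matrix.submatrix_mul_equiv, hY]

theorem dense_Lg_iff {k : ℕ} :
    Dense (Lg k R) ↔ Dense (leftInvertibleMatrices (Fin k) (Fin 1) R) := by
  constructor <;> intro h
  · refine h.of_mapsTo (f := fun a => Matrix.of fun i _ => a i) ?_ ?_ ?_
    · exact continuous_matrix fun i j => continuous_apply i
    · refine fun X => ⟨fun i => X i 0, ?_⟩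
      ext i j
      simp [Subsingleton.elim j 0]
    · intro a ha
      obtain ⟨c, hc⟩ := mem_Lg_iff.1 ha
      refine ⟨Matrix.of fun _ i => c i, ?_⟩
      ext i j
      simp [Matrix.mul_apply, hc, Matrix.one_apply, Subsingleton.elim i j]
  · refine h.of_mapsTo (f := fun X i => X i 0) ?_ ?_ ?_
    · exact continuous_pi fun i => continuous_id.matrix_elem i 0
    · exact fun a => ⟨Matrix.of fun i _ => a i, rfl⟩
    · rintro X ⟨Y, hY⟩
      refine mem_Lg_iff.2 ⟨fun i => Y 0 i, ?_⟩
      simpa [Matrix.mul_apply] using congrFun (congrFun hY 0) 0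

theorem dense_leftInvertibleMatrices_sum_left (h : Dense (leftInvertibleMatrices ι κ R)) :
    Dense (leftInvertibleMatrices (ι ⊕ ι') κ R) := by
  intro X
  have hcont : Continuous fun P : Matrix ι κ R => Matrix.fromRows P X.toRows₂ := by
    refine continuous_matrix ?_
    rintro (i | i) j
    · exact continuous_id.matrix_elem i j
    · exact continuous_const
  have := map_mem_closure hcont (h X.toRows₁) (t := leftInvertibleMatrices (ι ⊕ ι') κ R) ?_
  · simpa using this
  · rintro P ⟨Y, hY⟩
    exact ⟨Matrix.fromCols Y 0, by simp [Matrix.fromCols_mul_fromRows, hY]⟩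

/-- After a perturbation the last column has a left invertible upper part `q`. Row operations then
turn the corner into `1` and clear `q`, leaving a block triangular matrix whose upper left block can
be perturbed to be left invertible. -/
theorem dense_leftInvertibleMatrices_fromBlocks [DecidableEq ι] [IsTopologicalRing R]
    (h₁ : Dense (leftInvertibleMatrices ι (Fin 1) R)) (h : Dense (leftInvertibleMatrices ι κ R)) :
    Dense (leftInvertibleMatrices (ι ⊕ Fin 1) (κ ⊕ Fin 1) R) := by
  have key : ∀ (P : Matrix ι κ R) (q : Matrix ι (Fin 1) R) (r : Matrix (Fin 1) κ R)
      (s : Matrix (Fin 1) (Fin 1) R), q ∈ leftInvertibleMatrices ι (Fin 1) R →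
      Matrix.fromBlocks P q r s ∈
        closure (leftInvertibleMatrices (ι ⊕ Fin 1) (κ ⊕ Fin 1) R) := by
    rintro P q r s ⟨y, hy⟩
    -- Adding `t` times the upper rows to the last row changes the corner `s` to `1`; `K` undoes
    -- this operation and the clearing of `q`.
    set t : Matrix (Fin 1) ι R := (1 - s) * y with ht
    have htq : t * q = 1 - s := by rw [ht, Matrix.mul_assoc, hy, Matrix.mul_one]
    set r' := r + t * P with hr'
    let K : Matrix (ι ⊕ Fin 1) (ι ⊕ Fin 1) R :=
      Matrix.fromBlocks 1 0 (-t) 1 * Matrix.fromBlocks 1 q 0 1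
    have hK : K ∈ leftInvertibleMatrices (ι ⊕ Fin 1) (ι ⊕ Fin 1) R :=
      mul_mem_leftInvertibleMatrices
        ⟨Matrix.fromBlocks 1 0 t 1, by simp [Matrix.fromBlocks_multiply]⟩
        ⟨Matrix.fromBlocks 1 (-q) 0 1, by simp [Matrix.fromBlocks_multiply]⟩
    have hcont : Continuous fun W : Matrix ι κ R =>
        K * Matrix.fromBlocks W 0 r' (1 : Matrix (Fin 1) (Fin 1) R) :=
      continuous_const.matrix_mul
        (continuous_id.matrix_fromBlocks continuous_const continuous_const continuous_const)
    have := map_mem_closure hcont (h (P - q * r'))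
      (t := leftInvertibleMatrices (ι ⊕ Fin 1) (κ ⊕ Fin 1) R) ?_
    · convert this using 1
      have hr : r = -(t * (P - q * r')) + s * r' := by
        rw [Matrix.mul_sub, ← Matrix.mul_assoc, htq, Matrix.sub_mul, Matrix.one_mul, hr']
        abel
      simp [K, Matrix.fromBlocks_multiply, htq, ← hr]
    · rintro W ⟨V, hV⟩
      refine mul_mem_leftInvertibleMatrices hK ⟨Matrix.fromBlocks V 0 (-(r' * V)) 1, ?_⟩
      simp [Matrix.fromBlocks_multiply, hV, Matrix.mul_assoc]
  intro X
  have hcont : Continuous fun q : Matrix ι (Fin 1) R =>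
      Matrix.fromBlocks X.toBlocks₁₁ q X.toBlocks₂₁ X.toBlocks₂₂ :=
    continuous_const.matrix_fromBlocks continuous_id continuous_const continuous_const
  have := map_mem_closure hcont (h₁ X.toBlocks₁₂) fun q hq => key _ q _ _ hq
  rwa [closure_closure, Matrix.fromBlocks_toBlocks] at this

theorem dense_leftInvertibleMatrices_fin [IsTopologicalRing R] {k : ℕ} (h : Dense (Lg k R))
    (n : ℕ) : Dense (leftInvertibleMatrices (Fin (k + n)) (Fin n) R) := by
  induction n with
  | zero =>
    refine dense_univ.mono fun X _ => ⟨0, ?_⟩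
    ext i
    exact i.elim0
  | succ n ih =>
    refine dense_leftInvertibleMatrices_reindex (finSumFinEquiv (m := k + n) (n := 1))
      (finSumFinEquiv (m := n) (n := 1)) (dense_leftInvertibleMatrices_fromBlocks ?_ ih)
    exact dense_leftInvertibleMatrices_reindex finSumFinEquiv (Equiv.refl _)
      (dense_leftInvertibleMatrices_sum_left (ι' := Fin n) (dense_Lg_iff.1 h))

end LeftInvertible

/-- Approximate `diag(X, 1)` by a left invertible `Z`. Its corner is a unit, since units are open,
and the upper left block of a left inverse of `Z` is a left inverse of the Schur complement, which
is close to `X`. -/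
theorem dense_leftInvertibleMatrices_of_fromBlocks {R ι κ : Type*} [NormedRing R] [CompleteSpace R]
    [Fintype ι] [Fintype κ] [DecidableEq κ]
    (h : Dense (leftInvertibleMatrices (ι ⊕ Fin 1) (κ ⊕ Fin 1) R)) :
    Dense (leftInvertibleMatrices ι κ R) := by
  intro X
  let Z₀ : Matrix (ι ⊕ Fin 1) (κ ⊕ Fin 1) R := Matrix.fromBlocks X 0 0 1
  -- The Schur complement of the corner; the junk value of `Ring.inverse` at nonunits is irrelevant
  -- near `Z₀`.
  let f : Matrix (ι ⊕ Fin 1) (κ ⊕ Fin 1) R → Matrix ι κ R := fun Z => Matrix.of fun i j =>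
    Z (.inl i) (.inl j) - Z (.inl i) (.inr 0) * Ring.inverse (Z (.inr 0) (.inr 0)) *
      Z (.inr 0) (.inl j)
  have hentry : ∀ i j, ContinuousAt
      (fun Z : Matrix (ι ⊕ Fin 1) (κ ⊕ Fin 1) R => Z i j) Z₀ :=
    fun i j => (continuous_id.matrix_elem i j).continuousAt
  have hd : Z₀ (.inr 0) (.inr 0) = ((1 : Rˣ) : R) := by simp [Z₀]
  have hinv : ContinuousAt
      (fun Z : Matrix (ι ⊕ Fin 1) (κ ⊕ Fin 1) R => Ring.inverse (Z (.inr 0) (.inr 0))) Z₀ := by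
    refine ContinuousAt.comp (g := Ring.inverse) ?_ (hentry _ _)
    rw [hd]
    exact NormedRing.inverse_continuousAt 1
  have hf : ContinuousAt f Z₀ := by
    refine continuousAt_pi.2 fun i => continuousAt_pi.2 fun j => ?_
    exact (hentry _ _).sub (((hentry _ _).mul hinv).mul (hentry _ _))
  have hfZ : f Z₀ = X := by
    ext i j
    simp [f, Z₀]
  have hunit : ∀ᶠ Z in nhds Z₀, IsUnit (Z (.inr 0) (.inr 0)) :=
    (hentry _ _).eventually (hd ▸ Units.nhds 1 :
      ∀ᶠ y in nhds (Z₀ (.inr 0) (.inr 0)), IsUnit y)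
  rw [mem_closure_iff_frequently, ← hfZ]
  refine Filter.Tendsto.frequently hf
    (((mem_closure_iff_frequently.1 (h Z₀)).and_eventually hunit).mono ?_)
  rintro Z ⟨⟨Y, hY⟩, hZ⟩
  refine ⟨Y.toBlocks₁₁, ?_⟩
  have h1 : ∀ i j, ∑ x, Y (.inl i) (.inl x) * Z (.inl x) (.inl j) +
      Y (.inl i) (.inr 0) * Z (.inr 0) (.inl j) = (1 : Matrix κ κ R) i j := by
    intro i j
    simpa [Matrix.mul_apply, Matrix.one_apply] using congrFun (congrFun hY (.inl i)) (.inl j)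
  have h2 : ∀ i, ∑ x, Y (.inl i) (.inl x) * Z (.inl x) (.inr 0) +
      Y (.inl i) (.inr 0) * Z (.inr 0) (.inr 0) = 0 := by
    intro i
    simpa [Matrix.mul_apply, Matrix.one_apply] using congrFun (congrFun hY (.inl i)) (.inr 0)
  ext i j
  have h3 : (∑ x, Y (.inl i) (.inl x) * Z (.inl x) (.inr 0)) *
      (Ring.inverse (Z (.inr 0) (.inr 0)) * Z (.inr 0) (.inl j)) =
      -(Y (.inl i) (.inr 0) * Z (.inr 0) (.inl j)) := by
    rw [eq_neg_of_add_eq_zero_left (h2 i), neg_mul, mul_assoc, ← mul_assoc (Z _ _),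
      Ring.mul_inverse_cancel _ hZ, one_mul]
  rw [← h1, ← sub_neg_eq_add, ← h3, Finset.sum_mul, ← Finset.sum_sub_distrib, Matrix.mul_apply]
  exact Finset.sum_congr rfl fun x _ => by simp [f, Matrix.toBlocks₁₁, mul_sub, mul_assoc]

theorem dense_Lg_of_dense_leftInvertibleMatrices {R : Type*} [NormedRing R] [CompleteSpace R]
    {m : ℕ} (j : ℕ) (h : Dense (leftInvertibleMatrices (Fin (m + j)) (Fin (1 + j)) R)) :
    Dense (Lg m R) := by
  induction j with
  | zero => exact dense_Lg_iff.2 h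
  | succ j ih =>
    exact ih (dense_leftInvertibleMatrices_of_fromBlocks
      (dense_leftInvertibleMatrices_reindex (finSumFinEquiv (m := m + j) (n := 1)).symm
        (finSumFinEquiv (m := 1 + j) (n := 1)).symm h))

/-! ### Bimodule maps with an orthogonal quasi-basis -/

/-- A bimodule map `E : B → A` along a ring homomorphism `φ : A → B`, with an orthogonal
quasi-basis `(u i, v i)`. -/
structure IsOrthogonalBasisFor {A B : Type*} [Ring A] [Ring B] (φ : A →+* B) (E : B →+ A)
    {n : ℕ} (u v : Fin n → B) : Prop where
  map_left : ∀ a b, E (φ a * b) = a * E b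
  map_right : ∀ b a, E (b * φ a) = E b * a
  sum_left : ∀ b, ∑ i, u i * φ (E (v i * b)) = b
  sum_right : ∀ b, ∑ i, φ (E (b * u i)) * v i = b
  orthogonal : ∀ i j, E (v i * u j) = if i = j then 1 else 0

namespace IsOrthogonalBasisFor

variable {A B : Type*} {n : ℕ} {u v : Fin n → B}

/-- Reversing multiplication exchanges the roles of `u` and `v`, so each left-handed result yields
its right-handed counterpart. -/
theorem op [Ring A] [Ring B] {φ : A →+* B} {E : B →+ A} (h : IsOrthogonalBasisFor φ E u v) :
    IsOrthogonalBasisFor (RingHom.op φ) (AddMonoidHom.mulOp E)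
      (fun i => MulOpposite.op (v i)) (fun i => MulOpposite.op (u i)) where
  map_left a b := MulOpposite.unop_injective (h.map_right b.unop a.unop)
  map_right b a := MulOpposite.unop_injective (h.map_left a.unop b.unop)
  sum_left b := MulOpposite.unop_injective (by simpa using h.sum_right b.unop)
  sum_right b := MulOpposite.unop_injective (by simpa using h.sum_left b.unop)
  orthogonal i j := MulOpposite.unop_injective (by
    simpa [apply_ite MulOpposite.unop, eq_comm] using h.orthogonal j i)

theorem subsingleton [Ring A] [Ring B] {φ : A →+* B} {E : B →+ A} {u v : Fin 0 → B}
    (h : IsOrthogonalBasisFor φ E u v) : Subsingleton B :=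
  subsingleton_of_forall_eq 0 fun b => by simpa using (h.sum_left b).symm

theorem dense_Lg_codomain [Ring A] [Ring B] [TopologicalSpace A] [TopologicalSpace B]
    [IsTopologicalRing A] [IsTopologicalRing B] {φ : A →+* B} {E : B →+ A}
    (h : IsOrthogonalBasisFor φ E u v) (hφ : Continuous φ) {k : ℕ} (hk : Dense (Lg k A)) :
    Dense (Lg (k + n) B) := by
  refine (dense_leftInvertibleMatrices_fin hk n).of_mapsTo
    (f := fun X r => ∑ j, φ (X r j) * v j) ?_ ?_ ?_
  · exact continuous_pi fun r => continuous_finsetSum _ fun j _ =>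
      (hφ.comp (continuous_id.matrix_elem r j)).mul continuous_const
  · exact fun b => ⟨Matrix.of fun r j => E (b r * u j), funext fun r => h.sum_right (b r)⟩
  · rintro X ⟨Y, hY⟩
    -- A left inverse of the coordinate matrix recovers every `v i`, and the `v i` generate `1 = ∑
    -- i, φ (E (u i)) * v i`.
    have hv : ∀ i, ∑ r, φ (Y i r) * ∑ j, φ (X r j) * v j = v i := by
      intro i
      calc ∑ r, φ (Y i r) * ∑ j, φ (X r j) * v j
          = ∑ j, φ ((Y * X) i j) * v j := by
            simp only [Finset.mul_sum, Matrix.mul_apply, map_sum, map_mul, Finset.sum_mul,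
              mul_assoc]
            exact Finset.sum_comm
        _ = v i := by simp [hY, Matrix.one_apply, apply_ite φ]
    refine mem_Lg_iff.2 ⟨fun r => ∑ i, φ (E (u i)) * φ (Y i r), ?_⟩
    calc ∑ r, (∑ i, φ (E (u i)) * φ (Y i r)) * ∑ j, φ (X r j) * v j
        = ∑ i, φ (E (u i)) * ∑ r, φ (Y i r) * ∑ j, φ (X r j) * v j := by
          simp only [Finset.sum_mul, Finset.mul_sum (s := (Finset.univ : Finset (Fin (k + n)))),
            mul_assoc]
          exact Finset.sum_comm
      _ = 1 := by simpa [hv] using h.sum_right 1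

theorem dense_leftInvertibleMatrices [Ring A] [Ring B] [TopologicalSpace A] [TopologicalSpace B]
    [IsTopologicalRing B] {φ : A →+* B} {E : B →+ A} (h : IsOrthogonalBasisFor φ E u v)
    (hE : Continuous E) (i₀ : Fin n) {N : ℕ}
    (hN : Dense (leftInvertibleMatrices (Fin N) (Fin n) B)) :
    Dense (leftInvertibleMatrices (Fin N × Fin n) (Fin n) A) := by
  refine hN.of_mapsTo (f := fun X => Matrix.of fun rp j => E (v rp.2 * X rp.1 j)) ?_ ?_ ?_
  · exact continuous_matrix fun rp j =>
      hE.comp (continuous_const.mul (continuous_id.matrix_elem rp.1 j))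
  · refine fun T => ⟨Matrix.of fun r j => ∑ p, u p * φ (T (r, p) j), ?_⟩
    ext ⟨r, p⟩ j
    simp [Finset.mul_sum, ← mul_assoc, h.map_right, h.orthogonal]
  · rintro X ⟨Y, hY⟩
    -- `E 1` need not be `1`; the factor `v i₀ * u i₀` corrects this, as `E` sends it to `1`.
    refine ⟨Matrix.of fun i rp => E (v i₀ * u i₀ * Y i rp.1 * u rp.2), ?_⟩
    ext i j
    calc _ = ∑ r, E (v i₀ * u i₀ * Y i r * ∑ p, u p * φ (E (v p * X r j))) := by
            simp [Matrix.mul_apply, Fintype.sum_prod_type, Finset.mul_sum, ← mul_assoc, h.map_right]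
      _ = E (v i₀ * u i₀ * (Y * X) i j) := by
            simp [h.sum_left, Matrix.mul_apply, Finset.mul_sum, mul_assoc]
      _ = (1 : Matrix (Fin n) (Fin n) A) i j := by
            simp [hY, Matrix.one_apply, apply_ite E, h.orthogonal]

/-- Matrices of size `(k + n) × n` over `B` give size `n(k + n) × n` over `A`; removing `n - 1` rows
and columns leaves one column of length `nk + n² - n + 1`. -/
theorem dense_Lg_domain [NormedRing A] [CompleteSpace A] [Ring B] [TopologicalSpace B]
    [IsTopologicalRing B] {φ : A →+* B} {E : B →+ A} (h : IsOrthogonalBasisFor φ E u v)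
    (hE : Continuous E) (hn : n ≠ 0) {k : ℕ} (hk : Dense (Lg k B)) :
    Dense (Lg (n * k + (n ^ 2 - n + 1)) A) := by
  obtain ⟨j, rfl⟩ := Nat.exists_eq_succ_of_ne_zero hn
  have hA := h.dense_leftInvertibleMatrices hE 0 (dense_leftInvertibleMatrices_fin hk _)
  have hsq : (j + 1) ^ 2 - (j + 1) = (j + 1) * j := by
    rw [Nat.sub_eq_iff_eq_add (Nat.le_self_pow two_ne_zero _)]
    ring
  refine dense_Lg_of_dense_leftInvertibleMatrices j
    (dense_leftInvertibleMatrices_reindex (finProdFinEquiv.trans (finCongr ?_))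
      (finCongr (add_comm _ _)) hA)
  rw [Nat.succ_eq_add_one, hsq]
  ring

end IsOrthogonalBasisFor

/-! ### Topological stable ranks -/

section StableRank

variable {R : Type*} [Ring R] [TopologicalSpace R]

theorem ltsr_le {k : ℕ} (h : Dense (Lg k R)) : ltsr R ≤ k :=
  iInf₂_le k h

theorem exists_ltsr_eq (h : ltsr R < ⊤) : ∃ k : ℕ, Dense (Lg k R) ∧ ltsr R = k := by
  classical
  have hex : ∃ k, Dense (Lg k R) := by
    by_contra hne
    exact h.ne (iInf₂_eq_top.2 fun k hk => (hne ⟨k, hk⟩).elim)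
  exact ⟨Nat.find hex, Nat.find_spec hex, le_antisymm (ltsr_le (Nat.find_spec hex))
    (le_iInf₂ fun k hk => Nat.cast_le.2 (Nat.find_min' hex hk))⟩

theorem ltsr_eq_zero_of_subsingleton [Subsingleton R] : ltsr R = 0 :=
  nonpos_iff_eq_zero.1 (by
    simpa using ltsr_le (R := R) (k := 0) (dense_univ.mono fun a _ =>
      mem_Lg_iff.2 ⟨0, Subsingleton.elim _ _⟩))

theorem rtsr_eq_ltsr_op : rtsr R = ltsr Rᵐᵒᵖ := by
  have h : ∀ k, Dense (Rg k R) ↔ Dense (Lg k Rᵐᵒᵖ) := by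
    intro k
    constructor <;> intro h
    · refine h.of_mapsTo (f := fun a i => MulOpposite.op (a i)) ?_ ?_ ?_
      · exact continuous_pi fun i => MulOpposite.continuous_op.comp (continuous_apply i)
      · exact fun a => ⟨fun i => (a i).unop, rfl⟩
      · intro a ha
        obtain ⟨c, hc⟩ := mem_Rg_iff.1 ha
        exact mem_Lg_iff.2 ⟨fun i => MulOpposite.op (c i),
          MulOpposite.unop_injective (by simpa using hc)⟩
    · refine h.of_mapsTo (f := fun a i => (a i).unop) ?_ ?_ ?_
      · exact continuous_pi fun i => MulOpposite.continuous_unop.comp (continuous_apply i)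
      · exact fun a => ⟨fun i => MulOpposite.op (a i), rfl⟩
      · intro a ha
        obtain ⟨c, hc⟩ := mem_Lg_iff.1 ha
        exact mem_Rg_iff.2 ⟨fun i => (c i).unop, by simpa using congrArg MulOpposite.unop hc⟩
  simp only [rtsr, ltsr, h]

end StableRank

theorem IsOrthogonalBasisFor.ltsr_le_and_finite_iff {A B : Type*} [NormedRing A] [CompleteSpace A]
    [NormedRing B] {n : ℕ} {u v : Fin n → B} {φ : A →+* B} {E : B →+ A}
    (h : IsOrthogonalBasisFor φ E u v) (hφ : Continuous φ) (hφ' : Function.Injective φ)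
    (hE : Continuous E) :
    ltsr A ≤ (n : ℕ∞) * ltsr B + ((n ^ 2 - n + 1 : ℕ) : ℕ∞) ∧ (ltsr A < ⊤ ↔ ltsr B < ⊤) := by
  rcases eq_or_ne n 0 with rfl | hn
  -- An empty quasi-basis forces both rings to be trivial, with stable rank `0`.
  · have := h.subsingleton
    have := hφ'.subsingleton
    simp [ltsr_eq_zero_of_subsingleton]
  have hle : ∀ k : ℕ, Dense (Lg k B) → ltsr A ≤ ((n * k + (n ^ 2 - n + 1) : ℕ) : ℕ∞) :=
    fun k hk => ltsr_le (h.dense_Lg_domain hE hn hk)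
  refine ⟨?_, fun hA => ?_, fun hB => ?_⟩
  · rcases eq_or_ne (ltsr B) ⊤ with hB | hB
    · rw [hB, ENat.mul_top (by exact_mod_cast hn), top_add]
      exact le_top
    · obtain ⟨k, hk, hkB⟩ := exists_ltsr_eq hB.lt_top
      rw [hkB]
      exact_mod_cast hle k hk
  · obtain ⟨k, hk, -⟩ := exists_ltsr_eq hA
    exact (ltsr_le (h.dense_Lg_codomain hφ hk)).trans_lt (ENat.natCast_lt_top _)
  · obtain ⟨k, hk, -⟩ := exists_ltsr_eq hB
    exact (hle k hk).trans_lt (ENat.natCast_lt_top _)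

theorem mainTheorem4 {B : Type*} [NormedRing B] [NormedAlgebra ℂ B] [CompleteSpace B]
    (A : Subalgebra ℂ B) (hA : IsClosed (A : Set B))
    (E : B →ₗ[ℂ] A) (hE : IsBimoduleMap E)
    (n : ℕ) (u v : Fin n → B) (huv : IsQuasiBasis E u v)
    (hIndex : IsUnit (watataniIndex u v))
    (hContr : ∀ b : B, ‖E b‖ ≤ ‖b‖)
    (hOrth : IsOrthogonalFor E u v) :
    (ltsr A ≤ (n : ℕ∞) * ltsr B + ((n ^ 2 - n + 1 : ℕ) : ℕ∞) ∧ (ltsr A < ⊤ ↔ ltsr B < ⊤)) ∧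
    (rtsr A ≤ (n : ℕ∞) * rtsr B + ((n ^ 2 - n + 1 : ℕ) : ℕ∞) ∧ (rtsr A < ⊤ ↔ rtsr B < ⊤)) := by
  have : CompleteSpace A := hA.completeSpace_coe
  have h : IsOrthogonalBasisFor (A.val : A →+* B) (E : B →+ A) u v :=
    ⟨hE.map_left, hE.map_right, huv.sum_left, huv.sum_right, hOrth⟩
  have hφ : Continuous (A.val : A →+* B) := continuous_subtype_val
  have hφ' : Function.Injective (A.val : A →+* B) := Subtype.val_injective
  have hEc : Continuous (E : B →+ A) :=
    AddMonoidHomClass.continuous_of_bound E 1 fun b => by simpa using hContr b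
  refine ⟨h.ltsr_le_and_finite_iff hφ hφ' hEc, ?_⟩
  rw [rtsr_eq_ltsr_op, rtsr_eq_ltsr_op]
  refine h.op.ltsr_le_and_finite_iff ?_ ?_ ?_
  · exact MulOpposite.continuous_op.comp (hφ.comp MulOpposite.continuous_unop)
  · exact MulOpposite.op_injective.comp (hφ'.comp MulOpposite.unop_injective)
  · exact MulOpposite.continuous_op.comp (hEc.comp MulOpposite.continuous_unop)
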